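/- Let $f\in\mathbb{R}[x,y]$. A point $p\in\mathbb{R}^2$ is a strict local extremum of $f$ if $f(q)>f(p)$ for all $q\neq p$ in some neighbourhood of $p$, or $f(q)<f(p)$ for all $q\neq p$ in some neighbourhood of $p$. (If $f$ has only finitely many local extrema in the weak sense, then all of them are strict.) For $d\in\mathbb{N}$ let $\mu_{\mathrm{extr}}(d)$ be the maximum, over all $f\in\mathbb{R}[x,y]$ of total degree exactly $d$, of the number of strict local extrema of $f$ in $\mathbb{R}^2$. Then $\mu_{\mathrm{extr}}(d)$ is finite for every $d$, and $$\mu_{\mathrm{extr}}(d)\;\le\;\tfrac12 d^2+o(d^2)\qquad (d\to\infty),$$ that is, there is a function $e:\mathbb{N}\to\mathbb{R}$ with $e(d)/d^2\to 0$ as $d\to\infty$ such that $\mu_{\mathrm{extr}}(d)\le \tfrac12 d^2+e(d)$ for every $d\in\mathbb{N}$. -/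

import Mathlib

open Filter Topology Asymptotics

/-- The set of strict local extrema in the plane of a real polynomial in two variables: the
points `p` such that `f p < f q` for all `q ≠ p` near `p`, or `f q < f p` for all `q ≠ p`
near `p`. -/
def strictLocalExtrema (f : MvPolynomial (Fin 2) ℝ) : Set (Fin 2 → ℝ) :=
  {p | (∀ᶠ q in 𝓝[≠] p, MvPolynomial.eval p f < MvPolynomial.eval q f) ∨
       (∀ᶠ q in 𝓝[≠] p, MvPolynomial.eval q f < MvPolynomial.eval p f)}

/-- If a polynomial has only finitely many local extrema, in the weak sense, then they are all
strict; so counting strict local extrema then counts all the local extrema. -/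
theorem strictLocalExtrema_eq_of_finite (f : MvPolynomial (Fin 2) ℝ)
    (hf : {p : Fin 2 → ℝ | IsLocalExtr (fun q => MvPolynomial.eval q f) p}.Finite) :
    strictLocalExtrema f = {p | IsLocalExtr (fun q => MvPolynomial.eval q f) p} := by
  have hiso : ∀ p : Fin 2 → ℝ, ∀ᶠ q in 𝓝[≠] p,
      ¬ IsLocalExtr (fun q => MvPolynomial.eval q f) q := by
    intro p
    have h := (hf.subset (Set.sdiff_subset (t := {p}))).isClosed.isOpen_compl.mem_nhds
      (x := p) (by simp)
    filter_upwards [mem_nhdsWithin_of_mem_nhds h, self_mem_nhdsWithin] with q hq hqp hext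
    exact hq ⟨hext, hqp⟩
  ext p
  constructor
  · rintro (h | h)
    · refine Or.inl ?_
      filter_upwards [eventually_nhdsWithin_iff.1 h] with q hq
      by_cases hqp : q = p
      · simp [hqp]
      · exact (hq hqp).le
    · refine Or.inr ?_
      filter_upwards [eventually_nhdsWithin_iff.1 h] with q hq
      by_cases hqp : q = p
      · simp [hqp]
      · exact (hq hqp).le
  · rintro (h | h)
    · refine Or.inl ?_
      filter_upwards [hiso p, (eventually_eventually_nhds.2 h).filter_mono nhdsWithin_le_nhds]
        with q hq hq'
      refine lt_of_le_of_ne hq'.self_of_nhds fun heq => hq (Or.inl ?_)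
      filter_upwards [hq'] with r hr
      exact heq.ge.trans hr
    · refine Or.inr ?_
      filter_upwards [hiso p, (eventually_eventually_nhds.2 h).filter_mono nhdsWithin_le_nhds]
        with q hq hq'
      refine lt_of_le_of_ne hq'.self_of_nhds fun heq => hq (Or.inr ?_)
      filter_upwards [hq'] with r hr
      exact hr.trans heq.ge

/-- The maximal number of (strict) local extrema of a real polynomial in two variables of total
degree exactly `d`, as a supremum in `ℕ∞`; a finite such supremum is attained. -/
noncomputable def muExtr (d : ℕ) : ℕ∞ :=
  ⨆ f : {f : MvPolynomial (Fin 2) ℝ // f.totalDegree = d}, (strictLocalExtrema f.1).encard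

/-! The proof is a signature argument with the global residue. Let `f` have degree at most `n`.
Adding a small Fermat form of degree `n + 3` and a generic small linear form moves each strict
extremum to a nearby weak one (`exists_perturb`). Sard's lemma makes it nondegenerate, so its
Hessian determinant is positive. After scaling, the critical equations become `X 0 ^ m + g` and `X 1
^ m + h` with `m = n + 2` and `g`, `h` of degree less than `m`.

Let `A` be the quotient by these two polynomials; its dimension is at most `m ^ 2`. The residue is a
linear form on `A` that vanishes on degrees below `2 * (m - 1)`, so polynomials of degree at most
`n` form an isotropic subspace for `(a, b) ↦ residue (a * b)`. Each critical point `p` has an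
element `D p` with `residue (a * D p) = a p` and with the Jacobian at `p` as its value there
(`exists_socle`). The form is therefore positive definite on the span of the `D p` at points of
positive Jacobian.

A positive definite subspace meets an isotropic one only in zero, so the number of extrema plus `(n
+ 1) * (n + 2) / 2` is at most `(n + 2) ^ 2` (`card_add_card_triangle_le`). This leaves `(n + 2) *
(n + 3) / 2`. -/

/-! ### First and second order conditions at an extremum -/

/-- The Fréchet derivative of a polynomial function is given by the partial derivatives. -/
theorem MvPolynomial.hasFDerivAt_eval {σ : Type*} [Fintype σ] (P : MvPolynomial σ ℝ)
    (x : σ → ℝ) :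
    HasFDerivAt (fun q : σ → ℝ => eval q P)
      (∑ i, eval x (pderiv i P) • (ContinuousLinearMap.proj i : (σ → ℝ) →L[ℝ] ℝ)) x := by
  classical
  induction P using MvPolynomial.induction_on with
  | C a => simpa using hasFDerivAt_const a x
  | add P Q hP hQ => simpa [add_smul, Finset.sum_add_distrib] using hP.fun_add hQ
  | mul_X P n hP =>
    have h := hP.mul (hasFDerivAt_apply n x)
    simp only [map_mul, eval_X, pderiv_mul, map_add]
    refine h.congr_fderiv ?_
    ext v
    simp only [add_apply, smul_apply,
      sum_apply, ContinuousLinearMap.proj_apply, smul_eq_mul, add_mul,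
      Finset.sum_add_distrib, Finset.mul_sum, pderiv_X, Pi.single_apply, apply_ite (eval x),
      map_one, map_zero, mul_ite, ite_mul, mul_one, mul_zero, zero_mul]
    rw [add_comm]
    congr 1
    · exact Finset.sum_congr rfl fun i _ => by ring
    · simp

theorem MvPolynomial.hasDerivAt_eval_line {σ : Type*} [Fintype σ] (P : MvPolynomial σ ℝ)
    (x v : σ → ℝ) (t : ℝ) :
    HasDerivAt (fun t : ℝ => eval (x + t • v) P)
      (∑ i, eval (x + t • v) (pderiv i P) * v i) t := by
  have h1 : HasDerivAt (fun t : ℝ => x + t • v) v t := by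
    simpa using ((hasDerivAt_id t).smul_const v).const_add x
  refine ((P.hasFDerivAt_eval (x + t • v)).comp_hasDerivAt t h1).congr_deriv ?_
  simp [sum_apply]

theorem MvPolynomial.eval_pderiv_eq_zero_of_isLocalExtr {σ : Type*} [Fintype σ]
    {P : MvPolynomial σ ℝ} {x : σ → ℝ} (h : IsLocalExtr (fun q => eval q P) x) (i : σ) :
    eval x (pderiv i P) = 0 := by
  classical
  have := congrArg (fun L : (σ → ℝ) →L[ℝ] ℝ => L (Pi.single i 1))
    (h.hasFDerivAt_eq_zero (P.hasFDerivAt_eval x))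
  simpa [sum_apply, Pi.single_apply] using this

/-- The second order necessary condition for a local minimum on the line. -/
theorem IsLocalMin.deriv_deriv_nonneg {φ : ℝ → ℝ} {x : ℝ} (h : IsLocalMin φ x)
    (hc : ContinuousAt φ x) : 0 ≤ deriv (deriv φ) x := by
  by_contra! hneg
  -- A local minimum that is also a local maximum makes `φ` locally constant, so its second
  -- derivative vanishes.
  have hmax := isLocalMax_of_deriv_deriv_neg hneg h.deriv_eq_zero hc
  have hconst : φ =ᶠ[𝓝 x] fun _ => φ x := by
    filter_upwards [h, hmax] with y h1 h2 using le_antisymm h2 h1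
  have h2 : deriv φ =ᶠ[𝓝 x] fun _ => 0 := by
    filter_upwards [hconst.eventuallyEq_nhds] with y hy
    rw [hy.deriv_eq]
    simp
  rw [h2.deriv_eq] at hneg
  simp at hneg

theorem MvPolynomial.hessian_nonneg_of_isLocalMin {σ : Type*} [Fintype σ]
    {P : MvPolynomial σ ℝ} {x : σ → ℝ} (h : IsLocalMin (fun q => eval q P) x) (v : σ → ℝ) :
    0 ≤ ∑ i, (∑ j, eval x (pderiv j (pderiv i P)) * v j) * v i := by
  have hline : IsLocalMin (fun t : ℝ => eval (x + t • v) P) 0 := by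
    have hcont : ContinuousAt (fun t : ℝ => x + t • v) 0 := by fun_prop
    have : Tendsto (fun t : ℝ => x + t • v) (𝓝 0) (𝓝 x) := by
      simpa [ContinuousAt] using hcont
    simpa [IsLocalMin, IsMinFilter] using this.eventually h
  have h2 := hline.deriv_deriv_nonneg (P.hasDerivAt_eval_line x v 0).continuousAt
  have h3 : deriv (fun t : ℝ => eval (x + t • v) P) =
      fun t : ℝ => ∑ i, eval (x + t • v) (pderiv i P) * v i :=
    by
    funext t
    exact (P.hasDerivAt_eval_line x v t).deriv
  have h4 : HasDerivAt (fun t : ℝ => ∑ i, eval (x + t • v) (pderiv i P) * v i)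
      (∑ i, (∑ j, eval (x + (0 : ℝ) • v) (pderiv j (pderiv i P)) * v j) * v i) 0 :=
    HasDerivAt.fun_sum fun i _ => ((pderiv i P).hasDerivAt_eval_line x v 0).mul_const (v i)
  rw [h3, h4.deriv] at h2
  simpa using h2

/-- The commutator of two derivations is a derivation, and this one kills every variable. -/
theorem MvPolynomial.pderiv_pderiv_comm {σ R : Type*} [CommRing R] (i j : σ)
    (P : MvPolynomial σ R) : pderiv i (pderiv j P) = pderiv j (pderiv i P) := by
  classical
  have h : ⁅(pderiv i : Derivation R (MvPolynomial σ R) (MvPolynomial σ R)), (pderiv j : Derivation R (MvPolynomial σ R) (MvPolynomial σ R))⁆ =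
      (0 : Derivation R (MvPolynomial σ R) (MvPolynomial σ R)) := by
    refine MvPolynomial.derivation_ext fun k => ?_
    simp [Derivation.commutator_apply, pderiv_X, Pi.single_apply, apply_ite]
  have := congrArg (fun D : Derivation R (MvPolynomial σ R) (MvPolynomial σ R) => D P) h
  simpa [Derivation.commutator_apply, sub_eq_zero] using this

/-- The determinant of the Hessian of a polynomial in two variables. -/
noncomputable def MvPolynomial.hessianDet (P : MvPolynomial (Fin 2) ℝ) (x : Fin 2 → ℝ) : ℝ :=
  eval x (pderiv 0 (pderiv 0 P)) * eval x (pderiv 1 (pderiv 1 P)) -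
    eval x (pderiv 1 (pderiv 0 P)) * eval x (pderiv 0 (pderiv 1 P))

theorem MvPolynomial.hessianDet_nonneg_of_isLocalMin {P : MvPolynomial (Fin 2) ℝ}
    {x : Fin 2 → ℝ} (h : IsLocalMin (fun q => eval q P) x) : 0 ≤ P.hessianDet x := by
  unfold hessianDet
  have hq := fun a b : ℝ => hessian_nonneg_of_isLocalMin h ![a, b]
  simp only [Fin.sum_univ_two, Matrix.cons_val_zero, Matrix.cons_val_one,
    pderiv_pderiv_comm 0 1 P] at hq ⊢
  generalize eval x (pderiv 0 (pderiv 0 P)) = A at *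
  generalize eval x (pderiv 1 (pderiv 0 P)) = B at *
  generalize eval x (pderiv 1 (pderiv 1 P)) = D at *
  have hA : 0 ≤ A := by simpa using hq 1 0
  have hD : 0 ≤ D := by simpa using hq 0 1
  rcases hA.eq_or_lt with rfl | hA
  · rcases hD.eq_or_lt with rfl | hD
    · have h1 := hq 1 1
      have h2 := hq 1 (-1)
      have : B = 0 := by linarith
      simp [this]
    · refine nonneg_of_mul_nonneg_right (?_ : 0 ≤ D * _) hD
      -- At `(D, -B)` the quadratic form equals `D * (A * D - B ^ 2)`.
      linarith [hq D (-B)]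
  · refine nonneg_of_mul_nonneg_right (?_ : 0 ≤ A * _) hA
    linarith [hq (-B) A]

theorem MvPolynomial.hessianDet_nonneg_of_isLocalExtr {P : MvPolynomial (Fin 2) ℝ}
    {x : Fin 2 → ℝ} (h : IsLocalExtr (fun q => eval q P) x) : 0 ≤ P.hessianDet x := by
  rcases h with h | h
  · exact hessianDet_nonneg_of_isLocalMin h
  · have := hessianDet_nonneg_of_isLocalMin (P := -P) (x := x) (by simpa [IsLocalMin] using h.neg)
    simpa [hessianDet] using this

/-! ### Stability of extrema and Sard's lemma -/

/-- A strict local minimum persists, as a weak one, under continuous deformations. -/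
theorem eventually_exists_isLocalMin {T E : Type*} [TopologicalSpace T] [MetricSpace E]
    [ProperSpace E] {H : T → E → ℝ} (hH : Continuous fun z : T × E => H z.1 z.2) {t₀ : T}
    {p : E} {U : Set E} (hU : U ∈ 𝓝 p) (hp : ∀ᶠ q in 𝓝[≠] p, H t₀ p < H t₀ q) :
    ∀ᶠ t in 𝓝 t₀, ∃ p' ∈ U, IsLocalMin (H t) p' := by
  obtain ⟨r, hr, hsub⟩ := Metric.nhds_basis_closedBall.mem_iff.1
    (inter_mem hU (eventually_nhdsWithin_iff.1 hp))
  -- By compactness the strict inequality on a small sphere survives for `t` near `t₀`, so the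
  -- minimum over the closed ball lies in its interior.
  have htube : ∀ᶠ t in 𝓝 t₀, ∀ q ∈ Metric.sphere p r, H t p < H t q := by
    refine (isCompact_sphere p r).eventually_forall_of_forall_eventually fun q hq => ?_
    have hlt : H t₀ p < H t₀ q :=
      (hsub (Metric.sphere_subset_closedBall hq)).2 (Metric.ne_of_mem_sphere hq hr.ne')
    have h1 : Continuous fun z : T × E => H z.1 p :=
      hH.comp (continuous_fst.prodMk continuous_const)
    exact h1.continuousAt.eventually_lt hH.continuousAt hlt
  filter_upwards [htube] with t ht
  have hcont : Continuous (H t) := hH.comp (continuous_const.prodMk continuous_id)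
  obtain ⟨p', hp', hmin⟩ := (isCompact_closedBall p r).exists_isMinOn
    ⟨p, Metric.mem_closedBall_self hr.le⟩ hcont.continuousOn
  refine ⟨p', (hsub hp').1, hmin.isLocalMin ?_⟩
  refine Filter.mem_of_superset (Metric.isOpen_ball.mem_nhds ?_) Metric.ball_subset_closedBall
  rw [← Metric.closedBall_sdiff_sphere]
  exact ⟨hp', fun hs => (ht p' hs).not_ge (hmin (Metric.mem_closedBall_self hr.le))⟩

theorem eventually_exists_isLocalExtr {T E : Type*} [TopologicalSpace T] [MetricSpace E]
    [ProperSpace E] {H : T → E → ℝ} (hH : Continuous fun z : T × E => H z.1 z.2) {t₀ : T}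
    {p : E} {U : Set E} (hU : U ∈ 𝓝 p)
    (hp : (∀ᶠ q in 𝓝[≠] p, H t₀ p < H t₀ q) ∨ ∀ᶠ q in 𝓝[≠] p, H t₀ q < H t₀ p) :
    ∀ᶠ t in 𝓝 t₀, ∃ p' ∈ U, IsLocalExtr (H t) p' := by
  rcases hp with hp | hp
  · exact (eventually_exists_isLocalMin hH hU hp).mono fun t ⟨q, hq, h⟩ => ⟨q, hq, Or.inl h⟩
  · have := eventually_exists_isLocalMin (H := fun t q => -H t q) hH.neg (t₀ := t₀) hU
      (by simpa using hp)
    exact this.mono fun t ⟨q, hq, h⟩ => ⟨q, hq, Or.inr (by simpa [IsLocalMax] using h.neg)⟩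

/-- The critical values of the gradient map of a polynomial form a null set. -/
theorem MvPolynomial.volume_image_gradient_eq_zero (P : MvPolynomial (Fin 2) ℝ) :
    MeasureTheory.volume ((fun (q : Fin 2 → ℝ) (i : Fin 2) => eval q (pderiv i P)) ''
      {q | P.hessianDet q = 0}) = 0 := by
  let M : (Fin 2 → ℝ) → Matrix (Fin 2) (Fin 2) ℝ :=
    fun q => Matrix.of fun i j => eval q (pderiv j (pderiv i P))
  refine MeasureTheory.addHaar_image_eq_zero_of_det_fderivWithin_eq_zero MeasureTheory.volume
    (f' := fun q => LinearMap.toContinuousLinearMap (Matrix.toLin' (M q))) ?_ ?_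
  · intro q _
    refine HasFDerivAt.hasFDerivWithinAt (hasFDerivAt_pi'' fun i => ?_)
    refine ((pderiv i P).hasFDerivAt_eval q).congr_fderiv ?_
    ext v
    fin_cases i <;> simp [M]
  · intro q hq
    rw [LinearMap.det_toContinuousLinearMap, LinearMap.det_toLin', Matrix.det_fin_two]
    exact hq

/-! ### Monomials and the global residue -/

/-- The monomial exponent `(a, b)`. -/
noncomputable def expPair (a b : ℕ) : Fin 2 →₀ ℕ := Finsupp.single 0 a + Finsupp.single 1 b

@[simp] theorem expPair_zero (a b : ℕ) : expPair a b 0 = a := by simp [expPair]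

@[simp] theorem expPair_one (a b : ℕ) : expPair a b 1 = b := by simp [expPair]

theorem expPair_apply (s : Fin 2 →₀ ℕ) : expPair (s 0) (s 1) = s := by
  ext i; fin_cases i <;> simp

theorem expPair_inj {a b c d : ℕ} : expPair a b = expPair c d ↔ a = c ∧ b = d := by
  refine ⟨fun h => ⟨?_, ?_⟩, fun h => by rw [h.1, h.2]⟩
  · simpa using DFunLike.congr_fun h 0
  · simpa using DFunLike.congr_fun h 1

namespace MvPolynomial

theorem monomial_eq_smul_one (t : Fin 2 →₀ ℕ) (r : ℝ) :
    monomial t r = r • monomial t (1 : ℝ) := by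
  simp [smul_monomial]

theorem monomial_expPair (a b : ℕ) :
    monomial (expPair a b) (1 : ℝ) = X 0 ^ a * X 1 ^ b := by
  simp [expPair, X_pow_eq_monomial, monomial_mul]

theorem totalDegree_le_iff_forall_coeff {P : MvPolynomial (Fin 2) ℝ} {n : ℕ} :
    P.totalDegree ≤ n ↔ ∀ s, coeff s P ≠ 0 → s 0 + s 1 ≤ n := by
  simp [totalDegree, Finsupp.sum_fintype]

theorem add_le_totalDegree {P : MvPolynomial (Fin 2) ℝ} {s : Fin 2 →₀ ℕ} (h : s ∈ P.support) :
    s 0 + s 1 ≤ P.totalDegree :=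
  totalDegree_le_iff_forall_coeff.1 le_rfl s (mem_support_iff.1 h)

/-- The values on monomials of the global residue with respect to `X 0 ^ m + g`, `X 1 ^ m + h`,
where `g` and `h` have total degree less than `m`. -/
noncomputable def residueCoeff (m : ℕ) (g h : MvPolynomial (Fin 2) ℝ) (a b : ℕ) : ℝ :=
  if m ≤ a then
    -∑ t ∈ g.support,
      -- The guard only secures termination: it always holds when `g` has degree less than `m`.
      if a - m + t 0 + (b + t 1) < a + b then
        coeff t g * residueCoeff m g h (a - m + t 0) (b + t 1) else 0
  else if m ≤ b then
    -∑ t ∈ h.support,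
      if a + t 0 + (b - m + t 1) < a + b then
        coeff t h * residueCoeff m g h (a + t 0) (b - m + t 1) else 0
  else if a = m - 1 ∧ b = m - 1 then 1 else 0
termination_by a + b

/-- The global residue with respect to `X 0 ^ m + g`, `X 1 ^ m + h`, where `g` and `h` have total
degree less than `m`: the coefficient of `X 0 ^ (m - 1) * X 1 ^ (m - 1)` in the normal form. -/
noncomputable def residue (m : ℕ) (g h : MvPolynomial (Fin 2) ℝ) :
    MvPolynomial (Fin 2) ℝ →ₗ[ℝ] ℝ :=
  (basisMonomials (Fin 2) ℝ).constr ℝ fun s => residueCoeff m g h (s 0) (s 1)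

theorem residue_monomial (m : ℕ) (g h : MvPolynomial (Fin 2) ℝ) (s : Fin 2 →₀ ℕ) (r : ℝ) :
    residue m g h (monomial s r) = r * residueCoeff m g h (s 0) (s 1) := by
  have : monomial s r = r • basisMonomials (Fin 2) ℝ s := by
    rw [coe_basisMonomials, ← monomial_eq_smul_one]
  rw [this, map_smul, residue, Module.Basis.constr_basis, smul_eq_mul]

theorem residue_monomial_mul (m : ℕ) (g h : MvPolynomial (Fin 2) ℝ) (s : Fin 2 →₀ ℕ)
    (P : MvPolynomial (Fin 2) ℝ) :
    residue m g h (monomial s 1 * P) =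
      ∑ t ∈ P.support, coeff t P * residueCoeff m g h (s 0 + t 0) (s 1 + t 1) := by
  conv_lhs => rw [P.as_sum, Finset.mul_sum, map_sum]
  simp [monomial_mul, residue_monomial]

theorem residue_eq_sum (m : ℕ) (g h P : MvPolynomial (Fin 2) ℝ) :
    residue m g h P = ∑ t ∈ P.support, coeff t P * residueCoeff m g h (t 0) (t 1) := by
  simpa using residue_monomial_mul m g h 0 P

section residue

variable {m : ℕ} {g h : MvPolynomial (Fin 2) ℝ}

theorem residue_monomial_mul_left (hg : g.totalDegree < m) (s : Fin 2 →₀ ℕ) :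
    residue m g h (monomial s 1 * (X 0 ^ m + g)) = 0 := by
  rw [mul_add, map_add, X_pow_eq_monomial, monomial_mul, residue_monomial, residue_monomial_mul,
    residueCoeff, if_pos (by simp)]
  simp only [one_mul, Finsupp.add_apply, Finsupp.single_eq_same, add_tsub_cancel_right,
    neg_add_eq_zero, Finsupp.single_apply, mul_one]
  refine Finset.sum_congr rfl fun t ht => ?_
  have := add_le_totalDegree ht
  rw [if_pos (by simp; omega)]
  simp

theorem residue_mul_left (hg : g.totalDegree < m) (P : MvPolynomial (Fin 2) ℝ) :
    residue m g h (P * (X 0 ^ m + g)) = 0 := by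
  rw [P.as_sum, Finset.sum_mul, map_sum]
  refine Finset.sum_eq_zero fun t _ => ?_
  rw [monomial_eq_smul_one t (coeff t P), smul_mul_assoc, map_smul,
    residue_monomial_mul_left hg, smul_zero]

theorem residue_monomial_mul_right (hh : h.totalDegree < m) (s : Fin 2 →₀ ℕ) (hs : s 0 < m) :
    residue m g h (monomial s 1 * (X 1 ^ m + h)) = 0 := by
  rw [mul_add, map_add, X_pow_eq_monomial, monomial_mul, residue_monomial, residue_monomial_mul,
    residueCoeff, if_neg (by simpa using hs), if_pos (by simp)]
  simp only [one_mul, Finsupp.add_apply, Finsupp.single_eq_same, add_tsub_cancel_right,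
    neg_add_eq_zero, Finsupp.single_apply, mul_one]
  refine Finset.sum_congr rfl fun t ht => ?_
  have := add_le_totalDegree ht
  rw [if_pos (by simp; omega)]
  simp

/-- The recursion reduces the first variable first, so this is built in only for monomials with `t 0
< m`. Otherwise, reducing by `X 0 ^ m + g` replaces the multiplier by one of smaller degree, and
induction applies. -/
theorem residue_mul_right (hg : g.totalDegree < m) (hh : h.totalDegree < m)
    (P : MvPolynomial (Fin 2) ℝ) : residue m g h (P * (X 1 ^ m + h)) = 0 := by
  suffices H : ∀ n (P : MvPolynomial (Fin 2) ℝ), P.totalDegree < n →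
      residue m g h (P * (X 1 ^ m + h)) = 0 from H _ P (Nat.lt_succ_self _)
  intro n
  induction n with
  | zero => simp
  | succ n ih =>
    intro P hP
    rw [P.as_sum, Finset.sum_mul, map_sum]
    refine Finset.sum_eq_zero fun t ht => ?_
    rw [monomial_eq_smul_one t (coeff t P), smul_mul_assoc, map_smul,
      smul_eq_mul]
    refine mul_eq_zero_of_right _ ?_
    rcases lt_or_ge (t 0) m with h0 | h0
    · exact residue_monomial_mul_right hh t h0
    · have ht' := add_le_totalDegree ht
      have hsplit : monomial t (1 : ℝ) = X 0 ^ m * monomial (expPair (t 0 - m) (t 1)) 1 := by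
        have ht : t = Finsupp.single 0 m + expPair (t 0 - m) (t 1) := by
          ext i
          fin_cases i
          · simp; omega
          · simp
        rw [X_pow_eq_monomial, monomial_mul, one_mul, ← ht]
      have hrw : monomial t (1 : ℝ) * (X 1 ^ m + h) =
          monomial (expPair (t 0 - m) (t 1)) 1 * (X 1 ^ m + h) * (X 0 ^ m + g) -
            monomial (expPair (t 0 - m) (t 1)) 1 * g * (X 1 ^ m + h) := by
        rw [hsplit]; ring
      rw [hrw, map_sub, residue_mul_left hg, ih, sub_zero]
      refine (totalDegree_mul _ _).trans_lt ?_
      rw [totalDegree_monomial _ one_ne_zero, Finsupp.sum_fintype _ _ (by simp)]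
      simp
      omega

/-- Each reduction strictly lowers the total degree, so starting from degree at most `2 * (m - 1)`
it never reaches the socle exponent, which has exactly that degree. -/
theorem residueCoeff_eq (hm : 0 < m) {a b : ℕ}
    (hab : a + b ≤ 2 * (m - 1)) :
    residueCoeff m g h a b = if a = m - 1 ∧ b = m - 1 then 1 else 0 := by
  induction hn : a + b using Nat.strong_induction_on generalizing a b with
  | _ n ih =>
    rw [residueCoeff]
    split_ifs with h1 h2 h2 h3 h4 <;> try omega
    · rw [neg_eq_zero]
      refine Finset.sum_eq_zero fun t ht => ?_
      split_ifs with h3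
      · rw [ih _ (hn ▸ h3) (by omega) rfl, if_neg (by omega), mul_zero]
      · rfl
    · rw [neg_eq_zero]
      refine Finset.sum_eq_zero fun t ht => ?_
      split_ifs with h3
      · rw [ih _ (hn ▸ h3) (by omega) rfl, if_neg (by omega), mul_zero]
      · rfl
    all_goals rfl

theorem residue_eq_zero_of_totalDegree_lt (hm : 0 < m)
    {P : MvPolynomial (Fin 2) ℝ} (hP : P.totalDegree < 2 * (m - 1)) : residue m g h P = 0 := by
  rw [residue_eq_sum]
  refine Finset.sum_eq_zero fun t ht => ?_
  have := add_le_totalDegree ht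
  rw [residueCoeff_eq (m := m) (by omega) (by omega), if_neg (by omega), mul_zero]

theorem residue_socle (hm : 0 < m) :
    residue m g h (X 0 ^ (m - 1) * X 1 ^ (m - 1)) = 1 := by
  rw [← monomial_expPair, residue_monomial, expPair_zero, expPair_one,
    residueCoeff_eq (m := m) (by omega) (by omega)]
  simp

/-! ### The quotient algebra -/

/-- The ideal of `X 0 ^ m + g` and `X 1 ^ m + h`. -/
noncomputable def pairIdeal (m : ℕ) (g h : MvPolynomial (Fin 2) ℝ) :
    Ideal (MvPolynomial (Fin 2) ℝ) :=
  Ideal.span {X 0 ^ m + g, X 1 ^ m + h}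

theorem residue_eq_zero_of_mem (hg : g.totalDegree < m) (hh : h.totalDegree < m)
    {P : MvPolynomial (Fin 2) ℝ} (hP : P ∈ pairIdeal m g h) : residue m g h P = 0 := by
  obtain ⟨u, v, rfl⟩ := Ideal.mem_span_pair.1 hP
  rw [map_add, residue_mul_left hg, residue_mul_right hg hh, add_zero]

/-- Polynomials of low degree are independent modulo the ideal. -/
theorem eq_zero_of_mem_pairIdeal (hg : g.totalDegree < m) (hh : h.totalDegree < m)
    {P : MvPolynomial (Fin 2) ℝ} (hP : P ∈ pairIdeal m g h) (hdeg : P.totalDegree ≤ m - 1) :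
    P = 0 := by
  by_contra hne
  obtain ⟨s, hs, hmax⟩ := P.support.exists_max_image (fun s => s 0 + s 1)
    (Finset.nonempty_iff_ne_empty.2 (by simpa using hne))
  have hs' := add_le_totalDegree hs
  -- The multiplier sends the top-degree exponent `s` to the socle exponent and no other exponent of
  -- `P` there, so the residue reads off the coefficient at `s`.
  have h1 := residue_eq_zero_of_mem hg hh
    ((pairIdeal m g h).mul_mem_left (monomial (expPair (m - 1 - s 0) (m - 1 - s 1)) 1) hP)
  rw [residue_monomial_mul, Finset.sum_eq_single_of_mem s hs] at h1
  · rw [residueCoeff_eq (m := m) (by omega) (by simp; omega), if_pos (by simp; omega), mul_one] at h1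
    exact mem_support_iff.1 hs h1
  · intro t ht hts
    have := hmax t ht
    simp only [expPair_zero, expPair_one]
    rw [residueCoeff_eq (m := m) (by omega) (by omega), if_neg, mul_zero]
    rintro ⟨h2, h3⟩
    refine hts ?_
    rw [← expPair_apply t, ← expPair_apply s, expPair_inj]
    omega

/-- The quotient by the ideal is spanned by the monomials of degree less than `m` in each
variable. -/
theorem span_monomials_quotient_eq_top (hg : g.totalDegree < m) (hh : h.totalDegree < m) :
    Submodule.span ℝ (Set.range fun i : Fin m × Fin m =>
      Ideal.Quotient.mkₐ ℝ (pairIdeal m g h) (monomial (expPair i.1 i.2) 1)) = ⊤ := by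
  set W := Submodule.span ℝ (Set.range fun i : Fin m × Fin m =>
    Ideal.Quotient.mkₐ ℝ (pairIdeal m g h) (monomial (expPair i.1 i.2) 1)) with hW
  have hgen : X 0 ^ m + g ∈ pairIdeal m g h ∧ X 1 ^ m + h ∈ pairIdeal m g h :=
    ⟨Ideal.subset_span (by simp), Ideal.subset_span (by simp)⟩
  suffices H : ∀ n (P : MvPolynomial (Fin 2) ℝ), P.totalDegree < n →
      Ideal.Quotient.mkₐ ℝ (pairIdeal m g h) P ∈ W by
    refine eq_top_iff.2 fun x _ => ?_
    obtain ⟨P, rfl⟩ := Ideal.Quotient.mkₐ_surjective ℝ (pairIdeal m g h) x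
    exact H _ P (Nat.lt_succ_self _)
  intro n
  induction n with
  | zero => simp
  | succ n ih =>
    intro P hP
    rw [P.as_sum, map_sum]
    refine W.sum_mem fun t ht => ?_
    rw [monomial_eq_smul_one t (coeff t P), map_smul]
    refine W.smul_mem _ ?_
    have ht' := add_le_totalDegree ht
    have key : ∀ (i : Fin 2) (q : MvPolynomial (Fin 2) ℝ), q.totalDegree < m →
        X i ^ m + q ∈ pairIdeal m g h → m ≤ t i →
        Ideal.Quotient.mkₐ ℝ (pairIdeal m g h) (monomial t 1) ∈ W := by
      intro i q hq hmem hti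
      have hle : Finsupp.single i m ≤ t := by simpa using hti
      have hsplit : monomial t (1 : ℝ) = monomial (t - Finsupp.single i m) 1 * X i ^ m := by
        rw [X_pow_eq_monomial, monomial_mul, one_mul, tsub_add_cancel_of_le hle]
      have hcongr : Ideal.Quotient.mkₐ ℝ (pairIdeal m g h) (monomial t 1) =
          Ideal.Quotient.mkₐ ℝ (pairIdeal m g h) (-(monomial (t - Finsupp.single i m) 1 * q)) := by
        rw [Ideal.Quotient.mkₐ_eq_mk, Ideal.Quotient.eq, hsplit, sub_neg_eq_add, ← mul_add]
        exact Ideal.mul_mem_left _ _ hmem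
      rw [hcongr]
      refine ih _ ?_
      rw [totalDegree_neg]
      refine (totalDegree_mul _ _).trans_lt ?_
      rw [totalDegree_monomial _ one_ne_zero, Finsupp.sum_fintype _ _ (by simp)]
      fin_cases i <;> simp at hti ⊢ <;> omega
    by_cases h0 : m ≤ t 0
    · exact key 0 g hg hgen.1 h0
    by_cases h1 : m ≤ t 1
    · exact key 1 h hh hgen.2 h1
    · refine Submodule.subset_span ⟨(⟨t 0, not_le.1 h0⟩, ⟨t 1, not_le.1 h1⟩), ?_⟩
      simp [expPair_apply]

theorem finite_quotient_pairIdeal (hg : g.totalDegree < m) (hh : h.totalDegree < m) :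
    Module.Finite ℝ (MvPolynomial (Fin 2) ℝ ⧸ pairIdeal m g h) :=
  Module.Finite.of_fg_top (span_monomials_quotient_eq_top hg hh ▸
    Submodule.fg_span (Set.finite_range _))

theorem finrank_quotient_pairIdeal_le (hg : g.totalDegree < m) (hh : h.totalDegree < m) :
    Module.finrank ℝ (MvPolynomial (Fin 2) ℝ ⧸ pairIdeal m g h) ≤ m * m := by
  have h1 := finrank_range_le_card (R := ℝ) (fun i : Fin m × Fin m =>
      Ideal.Quotient.mkₐ ℝ (pairIdeal m g h) (monomial (expPair i.1 i.2) 1))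
  rw [Set.finrank, span_monomials_quotient_eq_top hg hh, finrank_top] at h1
  simpa using h1

end residue

/-! ### Hadamard decompositions and socle elements -/

theorem totalDegree_add_le {σ : Type*} {P Q : MvPolynomial σ ℝ} {n : ℕ}
    (hP : P.totalDegree ≤ n) (hQ : Q.totalDegree ≤ n) : (P + Q).totalDegree ≤ n :=
  (totalDegree_add P Q).trans (max_le hP hQ)

theorem totalDegree_mul_le {σ : Type*} {P Q : MvPolynomial σ ℝ} {a b n : ℕ}
    (hP : P.totalDegree ≤ a) (hQ : Q.totalDegree ≤ b) (hn : a + b ≤ n) :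
    (P * Q).totalDegree ≤ n :=
  ((totalDegree_mul P Q).trans (add_le_add hP hQ)).trans hn

/-- `P - P p` is a combination of the `X i - p i` with coefficients of total degree at most `n`. -/
def HasHadamard (p : Fin 2 → ℝ) (n : ℕ) (P : MvPolynomial (Fin 2) ℝ) : Prop :=
  ∃ u v : MvPolynomial (Fin 2) ℝ, u.totalDegree ≤ n ∧ v.totalDegree ≤ n ∧
    P - C (eval p P) = (X 0 - C (p 0)) * u + (X 1 - C (p 1)) * v

theorem hasHadamard_C (p : Fin 2 → ℝ) (n : ℕ) (r : ℝ) : HasHadamard p n (C r) :=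
  ⟨0, 0, by simp, by simp, by simp⟩

theorem HasHadamard.add {p : Fin 2 → ℝ} {n : ℕ} {P Q : MvPolynomial (Fin 2) ℝ}
    (hP : HasHadamard p n P) (hQ : HasHadamard p n Q) : HasHadamard p n (P + Q) := by
  obtain ⟨u, v, hu, hv, h⟩ := hP
  obtain ⟨u', v', hu', hv', h'⟩ := hQ
  refine ⟨u + u', v + v', totalDegree_add_le hu hu', totalDegree_add_le hv hv', ?_⟩
  simp only [map_add]
  linear_combination h + h'

theorem HasHadamard.C_mul {p : Fin 2 → ℝ} {n : ℕ} {P : MvPolynomial (Fin 2) ℝ}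
    (hP : HasHadamard p n P) (r : ℝ) : HasHadamard p n (C r * P) := by
  obtain ⟨u, v, hu, hv, h⟩ := hP
  refine ⟨C r * u, C r * v, totalDegree_mul_le (totalDegree_C r).le hu (by omega),
    totalDegree_mul_le (totalDegree_C r).le hv (by omega), ?_⟩
  simp only [map_mul, eval_C]
  linear_combination C r * h

theorem HasHadamard.mono {p : Fin 2 → ℝ} {n n' : ℕ} {P : MvPolynomial (Fin 2) ℝ}
    (hP : HasHadamard p n P) (hn : n ≤ n') : HasHadamard p n' P := by
  obtain ⟨u, v, hu, hv, h⟩ := hP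
  exact ⟨u, v, hu.trans hn, hv.trans hn, h⟩

theorem HasHadamard.X_mul {p : Fin 2 → ℝ} {n : ℕ} {P : MvPolynomial (Fin 2) ℝ}
    (hP : HasHadamard p n P) (hdeg : P.totalDegree ≤ n) (i : Fin 2) :
    HasHadamard p n (X i * P) := by
  obtain ⟨u, v, hu, hv, h⟩ := hP.C_mul (p i)
  simp only [map_mul, eval_C] at h
  fin_cases i
  · refine ⟨u + P, v, totalDegree_add_le hu hdeg, hv, ?_⟩
    simp only [map_mul, eval_X, Fin.zero_eta] at h ⊢
    linear_combination h
  · refine ⟨u, v + P, hu, totalDegree_add_le hv hdeg, ?_⟩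
    simp only [map_mul, eval_X, Fin.mk_one] at h ⊢
    linear_combination h

theorem hasHadamard_monomial (p : Fin 2 → ℝ) {n : ℕ} {t : Fin 2 →₀ ℕ} (ht : t 0 + t 1 ≤ n + 1) :
    HasHadamard p n (monomial t 1) := by
  induction n generalizing t with
  | zero =>
    by_cases h0 : t = 0
    · rw [h0]; exact hasHadamard_C p 0 1
    · obtain ⟨i, hi⟩ : ∃ i, t i ≠ 0 := DFunLike.ne_iff.1 h0
      have : t = Finsupp.single i 1 := by
        ext j
        fin_cases i <;> fin_cases j <;> simp at hi ⊢ <;> omega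
      rw [this, ← X, ← mul_one (X i)]
      exact (hasHadamard_C p 0 1).X_mul (by simp) i
  | succ n ih =>
    by_cases h0 : t = 0
    · rw [h0]; exact hasHadamard_C p _ 1
    · obtain ⟨i, hi⟩ : ∃ i, t i ≠ 0 := DFunLike.ne_iff.1 h0
      have hle : Finsupp.single i 1 ≤ t := by simpa using Nat.one_le_iff_ne_zero.2 hi
      have hsplit : monomial t (1 : ℝ) = X i * monomial (t - Finsupp.single i 1) 1 := by
        rw [X, monomial_mul, one_mul, add_tsub_cancel_of_le hle]
      have hdeg : (t - Finsupp.single i 1 : Fin 2 →₀ ℕ) 0 + (t - Finsupp.single i 1 : Fin 2 →₀ ℕ) 1 ≤ n + 1 := by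
        fin_cases i <;> simp at hi ⊢ <;> omega
      rw [hsplit]
      refine ((ih hdeg).mono n.le_succ).X_mul ?_ i
      rw [totalDegree_monomial _ one_ne_zero, Finsupp.sum_fintype _ _ (by simp)]
      simpa using hdeg

theorem hasHadamard_of_totalDegree_le (p : Fin 2 → ℝ) {n : ℕ} {P : MvPolynomial (Fin 2) ℝ}
    (hP : P.totalDegree ≤ n + 1) : HasHadamard p n P := by
  rw [P.as_sum]
  refine Finset.sum_induction _ (HasHadamard p n) (fun _ _ => HasHadamard.add)
    (by simpa using hasHadamard_C p n 0) fun t ht => ?_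
  rw [monomial_eq_smul_one, ← C_mul']
  exact (hasHadamard_monomial p ((add_le_totalDegree ht).trans hP)).C_mul _

/-- The Jacobian determinant of a pair of polynomials. -/
noncomputable def jacobianDet (P Q : MvPolynomial (Fin 2) ℝ) (x : Fin 2 → ℝ) : ℝ :=
  eval x (pderiv 0 P) * eval x (pderiv 1 Q) - eval x (pderiv 1 P) * eval x (pderiv 0 Q)

/-- Splitting off `(X i - C (p i)) * X i ^ (n + 1)` leaves a polynomial of degree at most `n + 1`,
so the other coefficients have degree at most `n`. This control of the leading terms fixes the
residue of the determinant in `exists_socle`. -/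
theorem exists_decomposition (p : Fin 2 → ℝ) {n : ℕ} {g : MvPolynomial (Fin 2) ℝ}
    (hg : g.totalDegree ≤ n + 1) (i : Fin 2) (h0 : eval p (X i ^ (n + 2) + g) = 0) :
    ∃ u v : MvPolynomial (Fin 2) ℝ, u.totalDegree ≤ n ∧ v.totalDegree ≤ n ∧
      X i ^ (n + 2) + g = (X i - C (p i)) * X i ^ (n + 1) + (X 0 - C (p 0)) * u +
        (X 1 - C (p 1)) * v := by
  have hdeg : (C (p i) * X i ^ (n + 1) + g).totalDegree ≤ n + 1 :=
    totalDegree_add_le (totalDegree_mul_le (totalDegree_C _).le (totalDegree_X_pow _ _).le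
      (by omega)) hg
  obtain ⟨u, v, hu, hv, h⟩ := hasHadamard_of_totalDegree_le p hdeg
  refine ⟨u, v, hu, hv, ?_⟩
  have h1 : eval p (C (p i) * X i ^ (n + 1) + g) = 0 := by
    rw [← h0]; simp; ring
  rw [h1, C_0] at h
  linear_combination h

/-- At a common zero `p` there is a polynomial which generates the annihilator of the ideal of `p`,
has residue one, and takes the Jacobian determinant as its value at `p`. -/
theorem exists_socle (p : Fin 2 → ℝ) {n : ℕ} {g h : MvPolynomial (Fin 2) ℝ}
    (hg : g.totalDegree ≤ n + 1) (hh : h.totalDegree ≤ n + 1)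
    (hg0 : eval p (X 0 ^ (n + 2) + g) = 0) (hh0 : eval p (X 1 ^ (n + 2) + h) = 0) :
    ∃ D : MvPolynomial (Fin 2) ℝ,
      (∀ a, a * D - C (eval p a) * D ∈ pairIdeal (n + 2) g h) ∧
      residue (n + 2) g h D = 1 ∧
      eval p D = jacobianDet (X 0 ^ (n + 2) + g) (X 1 ^ (n + 2) + h) p := by
  obtain ⟨u, v, hu, hv, huv⟩ := exists_decomposition p hg 0 hg0
  obtain ⟨w, z, hw, hz, hwz⟩ := exists_decomposition p hh 1 hh0
  -- The determinant of the matrix expressing the two generators through the `X i - C (p i)`. By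
  -- Cramer's rule its product with each `X i - C (p i)` lies in the ideal; at `p` the matrix is the
  -- Jacobian matrix.
  refine ⟨(X 0 ^ (n + 1) + u) * (X 1 ^ (n + 1) + z) - v * w, fun a => ?_, ?_, ?_⟩
  · obtain ⟨a0, a1, -, -, ha⟩ := hasHadamard_of_totalDegree_le p
      (Nat.le_succ a.totalDegree)
    refine Ideal.mem_span_pair.2
      ⟨a0 * (X 1 ^ (n + 1) + z) - a1 * w, a1 * (X 0 ^ (n + 1) + u) - a0 * v, ?_⟩
    rw [huv, hwz]
    linear_combination (-((X 0 ^ (n + 1) + u) * (X 1 ^ (n + 1) + z) - v * w)) * ha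
  · have hX : ∀ i : Fin 2, (X i ^ (n + 1) : MvPolynomial (Fin 2) ℝ).totalDegree ≤ n + 1 :=
      fun i => (totalDegree_X_pow _ _).le
    -- All terms except the socle monomial have degree at most `2 * n + 1`, where the residue
    -- vanishes.
    have hrw : (X 0 ^ (n + 1) + u) * (X 1 ^ (n + 1) + z) - v * w =
        X 0 ^ (n + 1) * X 1 ^ (n + 1) +
          (X 0 ^ (n + 1) * z + u * X 1 ^ (n + 1) + (u * z + -(v * w))) := by ring
    have h1 := residue_socle (m := n + 2) (g := g) (h := h) (by omega)
    rw [show n + 2 - 1 = n + 1 from rfl] at h1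
    rw [hrw, map_add, h1, residue_eq_zero_of_totalDegree_lt (by omega), add_zero]
    refine Nat.lt_of_le_of_lt (m := 2 * n + 1) ?_ (by omega)
    refine totalDegree_add_le (totalDegree_add_le ?_ ?_) (totalDegree_add_le ?_ ?_)
    · exact totalDegree_mul_le (hX 0) hz (by omega)
    · exact totalDegree_mul_le hu (hX 1) (by omega)
    · exact totalDegree_mul_le hu hz (by omega)
    · rw [totalDegree_neg]
      exact totalDegree_mul_le hv hw (by omega)
  · rw [jacobianDet, huv, hwz]
    simp [pderiv_X]

/-! ### The signature bound -/

/-- The exponents of the monomials of total degree at most `n`. -/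
def triangle (n : ℕ) : Finset (ℕ × ℕ) :=
  (Finset.range (n + 1)).biUnion fun k => Finset.HasAntidiagonal.antidiagonal k

theorem mem_triangle {n : ℕ} {t : ℕ × ℕ} : t ∈ triangle n ↔ t.1 + t.2 ≤ n := by
  simp [triangle]

theorem card_triangle (n : ℕ) : 2 * (triangle n).card = (n + 1) * (n + 2) := by
  rw [triangle, Finset.card_biUnion]
  · simp only [Finset.Nat.card_antidiagonal]
    induction n with
    | zero => rfl
    | succ n ih => rw [Finset.sum_range_succ, mul_add, ih]; ring
  · intro i _ j _ hij
    refine Finset.disjoint_left.2 fun t hi hj => hij ?_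
    rw [← Finset.HasAntidiagonal.mem_antidiagonal.1 hi, Finset.HasAntidiagonal.mem_antidiagonal.1 hj]

/-- The polynomial with prescribed coefficients in total degree at most `n`. -/
noncomputable def ofTriangle (n : ℕ) : (triangle n → ℝ) →ₗ[ℝ] MvPolynomial (Fin 2) ℝ :=
  Fintype.linearCombination ℝ fun t : triangle n => monomial (expPair t.1.1 t.1.2) (1 : ℝ)

theorem ofTriangle_apply (n : ℕ) (c : triangle n → ℝ) :
    ofTriangle n c = ∑ t, monomial (expPair t.1.1 t.1.2) (c t) := by
  simp [ofTriangle, Fintype.linearCombination_apply, smul_monomial]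

theorem totalDegree_ofTriangle_le (n : ℕ) (c : triangle n → ℝ) :
    (ofTriangle n c).totalDegree ≤ n := by
  rw [ofTriangle_apply]
  refine totalDegree_finsetSum_le fun t _ => (totalDegree_monomial_le _ _).trans ?_
  rw [Finsupp.sum_fintype _ _ (by simp)]
  simpa using mem_triangle.1 t.2

theorem ofTriangle_injective (n : ℕ) : Function.Injective (ofTriangle n) := by
  refine (injective_iff_map_eq_zero _).2 fun c hc => _root_.funext fun t => ?_
  have := congrArg (coeff (expPair t.1.1 t.1.2)) hc
  rw [ofTriangle_apply, coeff_sum, Finset.sum_eq_single t] at this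
  · simpa using this
  · intro t' _ hne
    rw [coeff_monomial, if_neg]
    rw [expPair_inj]
    exact fun h => hne (Subtype.ext (Prod.ext h.1 h.2))
  · simp

/-- A bound for the number of common zeros with positive Jacobian determinant. -/
theorem card_add_card_triangle_le {n : ℕ} {g h : MvPolynomial (Fin 2) ℝ}
    (hg : g.totalDegree ≤ n + 1) (hh : h.totalDegree ≤ n + 1) (S : Finset (Fin 2 → ℝ))
    (hg0 : ∀ p ∈ S, eval p (X 0 ^ (n + 2) + g) = 0)
    (hh0 : ∀ p ∈ S, eval p (X 1 ^ (n + 2) + h) = 0)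
    (hJ : ∀ p ∈ S, 0 < jacobianDet (X 0 ^ (n + 2) + g) (X 1 ^ (n + 2) + h) p) :
    S.card + (triangle n).card ≤ (n + 2) * (n + 2) := by
  set I := pairIdeal (n + 2) g h
  have hg' : g.totalDegree < n + 2 := by omega
  have hh' : h.totalDegree < n + 2 := by omega
  let φ := residue (n + 2) g h
  have hφ : ∀ P ∈ I, φ P = 0 := fun P hP => residue_eq_zero_of_mem hg' hh' hP
  choose D hDI hD1 hDJ using fun p : S =>
    exists_socle p.1 hg hh (hg0 p.1 p.2) (hh0 p.1 p.2)
  have hφD : ∀ (p : S) (a : MvPolynomial (Fin 2) ℝ), φ (a * D p) = eval p.1 a := by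
    intro p a
    have h1 := hφ _ (hDI p a)
    rw [map_sub, C_mul', map_smul, hD1 p, sub_eq_zero] at h1
    simpa using h1
  have hDne : ∀ p q : S, p ≠ q → eval p.1 (D q) = 0 := by
    intro p q hpq
    obtain ⟨k, hk⟩ : ∃ k, p.1 k ≠ q.1 k := by
      by_contra! hcon
      exact hpq (Subtype.ext (_root_.funext hcon))
    have hmem : (X k - C (q.1 k)) * D q ∈ I := by
      have h1 := hDI q (X k - C (q.1 k))
      have h2 : eval q.1 (X k - C (q.1 k)) = 0 := by simp
      rwa [h2, C_0, zero_mul, sub_zero] at h1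
    have h1 := hφD p ((X k - C (q.1 k)) * D q)
    rw [hφ _ (I.mul_mem_right _ hmem), map_mul] at h1
    refine (mul_eq_zero.1 h1.symm).resolve_left ?_
    simpa [sub_eq_zero] using hk
  let Φ : (S → ℝ) × (triangle n → ℝ) →ₗ[ℝ] MvPolynomial (Fin 2) ℝ :=
    (Fintype.linearCombination ℝ D).coprod (ofTriangle n)
  let Ψ := (Ideal.Quotient.mkₐ ℝ I).toLinearMap ∘ₗ Φ
  have hΨ : Function.Injective Ψ := by
    refine (injective_iff_map_eq_zero _).2 ?_
    rintro ⟨c, e⟩ hce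
    set s := Fintype.linearCombination ℝ D c with hs
    set l := ofTriangle n e with hl
    have hmem : s + l ∈ I := Ideal.Quotient.eq_zero_iff_mem.1 hce
    -- Since `s + l` lies in the ideal, the residue kills `(s - l) * (s + l)`, so `s` and `l` have
    -- the same square; that of `l` is zero because `2 * n < 2 * (n + 1)`.
    have hss : φ (s * s) = 0 := by
      have h1 := hφ _ (I.mul_mem_left (s - l) hmem)
      have h2 : φ (l * l) = 0 := by
        refine residue_eq_zero_of_totalDegree_lt (by omega)
          (Nat.lt_of_le_of_lt (m := 2 * n) ?_ (by omega))
        exact totalDegree_mul_le (totalDegree_ofTriangle_le n e)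
          (totalDegree_ofTriangle_le n e) (by omega)
      rw [show (s - l) * (s + l) = s * s - l * l by ring, map_sub, h2, sub_zero] at h1
      exact h1
    have hsp : ∀ p : S, eval p.1 s = c p * eval p.1 (D p) := by
      intro p
      rw [hs, Fintype.linearCombination_apply, map_sum, Finset.sum_eq_single p]
      · simp
      · intro q _ hqp
        simp [hDne p q hqp.symm]
      · simp
    -- The residue form is diagonal on the `D p`, with the positive Jacobians as diagonal entries.
    have hsum : φ (s * s) = ∑ p : S, c p ^ 2 * eval p.1 (D p) := by
      have h1 : s * s = ∑ p : S, s * (c p • D p) := by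
        rw [← Finset.mul_sum, ← Fintype.linearCombination_apply]
      rw [h1, map_sum]
      refine Finset.sum_congr rfl fun p _ => ?_
      rw [mul_smul_comm, map_smul, hφD, hsp, smul_eq_mul]
      ring
    have hpos : ∀ p : S, 0 < eval p.1 (D p) := fun p => by rw [hDJ]; exact hJ p.1 p.2
    have hc : c = 0 := by
      rw [hsum, Finset.sum_eq_zero_iff_of_nonneg
        (fun p _ => mul_nonneg (sq_nonneg _) (hpos p).le)] at hss
      funext p
      simpa [(hpos p).ne'] using hss p (Finset.mem_univ p)
    have hs0 : s = 0 := by rw [hs, hc, map_zero]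
    have hl0 : l = 0 := by
      rw [hs0, zero_add] at hmem
      exact eq_zero_of_mem_pairIdeal hg' hh' hmem
        ((totalDegree_ofTriangle_le n e).trans (by omega))
    have he : e = 0 := ofTriangle_injective n (by rw [← hl, hl0, map_zero])
    rw [hc, he]
    rfl
  have := finite_quotient_pairIdeal hg' hh'
  have h1 := (LinearMap.finrank_le_finrank_of_injective hΨ).trans
    (finrank_quotient_pairIdeal_le hg' hh')
  simpa using h1

/-! ### Perturbation to a regular system -/

theorem totalDegree_pderiv_le (f : MvPolynomial (Fin 2) ℝ) (i : Fin 2) :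
    (pderiv i f).totalDegree ≤ f.totalDegree := by
  refine totalDegree_le_iff_forall_coeff.2 fun s hs => ?_
  rw [coeff_pderiv] at hs
  have := totalDegree_le_iff_forall_coeff.1 le_rfl _ (left_ne_zero_of_mul hs)
  simp only [Finsupp.add_apply] at this
  omega

/-- The perturbation of `f` by a Fermat form with coefficient `t.1` and a linear form with
coefficients `-t.2`. -/
noncomputable def perturb (f : MvPolynomial (Fin 2) ℝ) (n : ℕ) (t : ℝ × (Fin 2 → ℝ)) :
    MvPolynomial (Fin 2) ℝ :=
  f + C t.1 * (X 0 ^ (n + 3) + X 1 ^ (n + 3)) - (C (t.2 0) * X 0 + C (t.2 1) * X 1)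

theorem continuous_eval_perturb (f : MvPolynomial (Fin 2) ℝ) (n : ℕ) :
    Continuous fun z : (ℝ × (Fin 2 → ℝ)) × (Fin 2 → ℝ) => eval z.2 (perturb f n z.1) := by
  have h : Continuous fun z : (ℝ × (Fin 2 → ℝ)) × (Fin 2 → ℝ) => eval z.2 f :=
    (MvPolynomial.continuous_eval f).comp continuous_snd
  simp only [perturb, map_add, map_sub, map_mul, map_pow, eval_X, eval_C]
  fun_prop

theorem pderiv_perturb (f : MvPolynomial (Fin 2) ℝ) (n : ℕ) (t : ℝ × (Fin 2 → ℝ)) (i : Fin 2) :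
    pderiv i (perturb f n t) =
      pderiv i f + C (t.1 * (n + 3)) * X i ^ (n + 2) - C (t.2 i) := by
  have h3 : (C 3 : MvPolynomial (Fin 2) ℝ) = 3 := C_eq_coe_nat 3
  fin_cases i <;> simp [perturb, pderiv_X, h3] <;> ring

/-- The strict local extrema give a regular perturbation with as many nondegenerate critical
points of positive Hessian determinant. -/
theorem exists_perturb (f : MvPolynomial (Fin 2) ℝ) (n : ℕ) (S : Finset (Fin 2 → ℝ))
    (hS : ∀ p ∈ S, p ∈ strictLocalExtrema f) :
    ∃ t : ℝ × (Fin 2 → ℝ), 0 < t.1 ∧ ∃ S' : Finset (Fin 2 → ℝ), S'.card = S.card ∧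
      ∀ q ∈ S', (∀ i, eval q (pderiv i (perturb f n t)) = 0) ∧
        0 < (perturb f n t).hessianDet q := by
  classical
  -- Disjoint neighbourhoods keep the perturbed extrema distinct.
  obtain ⟨U, hU, hdisj⟩ := S.finite_toSet.t2_separation
  have hpert : perturb f n 0 = f := by simp [perturb]
  have hev : ∀ᶠ t in 𝓝 (0 : ℝ × (Fin 2 → ℝ)), ∀ p ∈ S, ∃ p' ∈ U p,
      IsLocalExtr (fun q => eval q (perturb f n t)) p' := by
    refine (eventually_all_finset S).2 fun p hp => ?_
    refine eventually_exists_isLocalExtr (H := fun t q => eval q (perturb f n t))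
      (continuous_eval_perturb f n) ((hU p).2.mem_nhds (hU p).1) ?_
    simp only [hpert]
    exact hS p hp
  obtain ⟨A, hA, B, hB, hAB⟩ := mem_nhds_prod_iff.1 hev
  obtain ⟨ε, hεA, hε⟩ : ∃ ε, ε ∈ A ∧ (0 : ℝ) < ε :=
    nonempty_of_mem (inter_mem (mem_nhdsWithin_of_mem_nhds hA) (self_mem_nhdsWithin :
      Set.Ioi (0 : ℝ) ∈ 𝓝[>] (0 : ℝ)))
  -- Subtracting the linear form shifts the gradient by `v` and leaves the Hessian unchanged.
  -- Critical points are then preimages of `v`, so a regular value `v` makes them all nondegenerate;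
  -- the null set of critical values cannot contain `B`.
  obtain ⟨v, hvB, hv⟩ : ∃ v ∈ B, v ∉ (fun (q : Fin 2 → ℝ) (i : Fin 2) =>
      eval q (pderiv i (perturb f n (ε, 0)))) '' {q | (perturb f n (ε, 0)).hessianDet q = 0} := by
    by_contra! hcon
    exact (MeasureTheory.Measure.measure_pos_of_mem_nhds MeasureTheory.volume hB).ne'
      (MeasureTheory.measure_mono_null hcon (volume_image_gradient_eq_zero _))
  have hex : ∀ p ∈ S, ∃ p' ∈ U p, IsLocalExtr (fun q => eval q (perturb f n (ε, v))) p' :=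
    hAB (Set.mk_mem_prod hεA hvB)
  choose! e heU he using hex
  refine ⟨(ε, v), hε, S.image e, Finset.card_image_of_injOn fun p hp q hq hpq => ?_,
    Finset.forall_mem_image.2 fun p hp => ?_⟩
  · by_contra hne
    exact Set.disjoint_left.1 (hdisj hp hq hne) (heU p hp) (hpq ▸ heU q hq)
  · have hcrit := fun i => eval_pderiv_eq_zero_of_isLocalExtr (he p hp) i
    refine ⟨hcrit, lt_of_le_of_ne (hessianDet_nonneg_of_isLocalExtr (he p hp)) fun h0 => hv ?_⟩
    refine ⟨e p, ?_, _root_.funext fun i => ?_⟩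
    · rw [Set.mem_ofPred_eq, h0]
      simp [hessianDet, pderiv_perturb]
    · have := hcrit i
      simp only [pderiv_perturb, map_sub, map_add, eval_C, sub_eq_zero] at this
      simpa [pderiv_perturb] using this

theorem card_add_card_triangle_le_of_strictLocalExtrema {f : MvPolynomial (Fin 2) ℝ} {n : ℕ}
    (hf : f.totalDegree ≤ n) (S : Finset (Fin 2 → ℝ)) (hS : ∀ p ∈ S, p ∈ strictLocalExtrema f) :
    S.card + (triangle n).card ≤ (n + 2) * (n + 2) := by
  obtain ⟨t, ht, S', hcard, hS'⟩ := exists_perturb f n S hS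
  have hn : (0 : ℝ) < n + 3 := by positivity
  -- This scaling makes both partial derivatives monic in their pure powers; it multiplies the
  -- Jacobian by `c ^ 2 > 0`.
  set c : ℝ := (t.1 * (n + 3))⁻¹ with hc
  have hcpos : 0 < c := by positivity
  let g : Fin 2 → MvPolynomial (Fin 2) ℝ := fun i => C c * (pderiv i f - C (t.2 i))
  have hg : ∀ i, X i ^ (n + 2) + g i = C c * pderiv i (perturb f n t) := by
    intro i
    have h1 : (C c * C (t.1 * (n + 3)) : MvPolynomial (Fin 2) ℝ) = 1 := by
      rw [← C_mul, hc, inv_mul_cancel₀ (by positivity), C_1]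
    rw [pderiv_perturb]
    linear_combination (-(X i ^ (n + 2) : MvPolynomial (Fin 2) ℝ)) * h1
  have hdeg : ∀ i, (g i).totalDegree ≤ n + 1 := fun i =>
    totalDegree_mul_le (totalDegree_C c).le ((totalDegree_sub_C_le _ _).trans
      ((totalDegree_pderiv_le f i).trans hf)) (by omega)
  rw [← hcard]
  refine card_add_card_triangle_le (hdeg 0) (hdeg 1) S' (fun p hp => ?_) (fun p hp => ?_)
    fun p hp => ?_
  · rw [hg, map_mul, (hS' p hp).1, mul_zero]
  · rw [hg, map_mul, (hS' p hp).1, mul_zero]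
  · have : jacobianDet (X 0 ^ (n + 2) + g 0) (X 1 ^ (n + 2) + g 1) p =
        c ^ 2 * (perturb f n t).hessianDet p := by
      rw [hg, hg, jacobianDet, hessianDet]
      simp only [pderiv_C_mul, map_mul, eval_C]
      ring
    rw [this]
    exact mul_pos (pow_pos hcpos 2) (hS' p hp).2

end MvPolynomial

/-! ### The explicit bound and its asymptotics -/

theorem muExtr_le (d : ℕ) : muExtr d ≤ (((d + 2) * (d + 3) / 2 : ℕ) : ℕ∞) := by
  refine iSup_le fun f => ?_
  by_contra! hlt
  -- Taking a finite subset with one point too many also covers an infinite set of extrema.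
  obtain ⟨T, hT, hTcard⟩ := Set.exists_subset_encard_eq (Order.add_one_le_of_lt hlt)
  have hfin : T.Finite := Set.finite_of_encard_eq_coe (k := (d + 2) * (d + 3) / 2 + 1)
    (by rw [hTcard]; rfl)
  have h1 := MvPolynomial.card_add_card_triangle_le_of_strictLocalExtrema f.2.le hfin.toFinset
    fun p hp => hT (hfin.mem_toFinset.1 hp)
  have h2 := MvPolynomial.card_triangle d
  have h3 : hfin.toFinset.card = (d + 2) * (d + 3) / 2 + 1 := by
    rw [hfin.encard_eq_coe_toFinset_card] at hTcard
    exact_mod_cast hTcard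
  rw [h3] at h1
  have h4 : (d + 2) * (d + 3) < 2 * ((d + 2) * (d + 3) / 2 + 1) := by omega
  nlinarith

theorem mainTheorem8 :
    (∀ d : ℕ, muExtr d ≠ ⊤) ∧
    ∃ e : ℕ → ℝ, e =o[atTop] (fun d : ℕ => (d : ℝ) ^ 2) ∧
      ∀ d : ℕ, ((muExtr d).toNat : ℝ) ≤ (1 / 2 : ℝ) * (d : ℝ) ^ 2 + e d := by
  refine ⟨fun d => ne_top_of_le_ne_top (ENat.natCast_ne_top _) (muExtr_le d),
    -- The error term is the remainder in `(d + 2) * (d + 3) / 2 = d ^ 2 / 2 + 5 / 2 * d + 3`.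
    fun d => 5 / 2 * (d : ℝ) + 3, ?_, fun d => ?_⟩
  · have h1 : (fun d : ℕ => (d : ℝ)) =o[atTop] fun d : ℕ => (d : ℝ) ^ 2 := by
      simpa [Function.comp_def] using (isLittleO_pow_pow_atTop_of_lt (𝕜 := ℝ) one_lt_two).comp_tendsto
        tendsto_natCast_atTop_atTop
    have h2 : (fun _ : ℕ => (3 : ℝ)) =o[atTop] fun d : ℕ => (d : ℝ) ^ 2 :=
      isLittleO_const_left.2 (Or.inr <| tendsto_norm_atTop_atTop.comp <|
        (tendsto_pow_atTop two_ne_zero).comp tendsto_natCast_atTop_atTop)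
    exact (h1.const_mul_left (5 / 2)).add h2
  · have h1 : (muExtr d).toNat ≤ (d + 2) * (d + 3) / 2 :=
      ENat.toNat_le_of_le_natCast (muExtr_le d)
    have h2 : (muExtr d).toNat * 2 ≤ (d + 2) * (d + 3) :=
      (Nat.le_div_iff_mul_le two_pos).1 h1
    have h3 : ((muExtr d).toNat : ℝ) * 2 ≤ (d + 2) * (d + 3) := by exact_mod_cast h2
    linarith
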